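/- Let $F$ be a field of arbitrary characteristic and let $\mathcal O$ be a Cayley algebra over $F$ with norm form $n$, that is, an $8$-dimensional unital, not necessarily associative $F$-algebra with a nonsingular quadratic form $n$ such that $n(xy)=n(x)n(y)$ for all $x,y\in\mathcal O$. Let $b$ be the polar form of $n$, put $\bar x=b(x,1)1-x$, and let $x\star y=\bar x\,\bar y$ be the para-Cayley product. A similitude of $(\mathcal O,n)$ is a bijective linear map $t$ such that $n(t(x))=\mu(t)n(x)$ for all $x$, with multiplier $\mu(t)\in F^\times$; it is proper if the automorphism $\mathcal C_0(t)$ of the even Clifford algebra $\mathcal C_0(n)$, given by $\mathcal C_0(t)(xy)=\mu(t)^{-1}t(x)t(y)$ for $x,y\in\mathcal O$, is the identity on the center of $\mathcal C_0(n)$. Let $GO^+(n)$ be the group of proper similitudes, let $PGO^+(n)=GO^+(n)/F^\times$ be its quotient by the homotheties, and write $[t]$ for the class of $t$. 1. For every proper similitude $t$ of $(\mathcal O,n)$ there exist proper similitudes $t^+,t^-$ of $(\mathcal O,n)$ such that, for all $x,y\in\mathcal O$, (a) $t^+(x\star y)=\mu(t^+)\,t(x)\star t^-(y)$; (b) $t(x\star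 y)=\mu(t)\,t^-(x)\star t^+(y)$; (c) $t^-(x\star y)=\mu(t^-)\,t^+(x)\star t(y)$. 2. The pair $(t^+,t^-)$ is uniquely determined by $t$ up to a factor $(\lambda^{-1},\lambda)$: if $(t^+,t^-)$ is one such pair, then the pairs of proper similitudes satisfying (a), (b), (c) are exactly the pairs $(\lambda^{-1}t^+,\lambda t^-)$ with $\lambda\in F^\times$. 3. For every such pair, $\mu(t^+)\,\mu(t)\,\mu(t^-)=1$. 4. The assignments $\theta^+([t])=[t^+]$ and $\theta^-([t])=[t^-]$ define an action of the alternating group $A_3\simeq\mathbb Z/3$ on the group $PGO^+(n)$ by group automorphisms: if $\rho\in A_3$ denotes a fixed $3$-cycle, there is exactly one homomorphism $\theta\colon A_3\to\operatorname{Aut}(PGO^+(n))$ such that $\theta(\rho)[t]=[t^+]$ and $\theta(\rho^{-1})[t]=[t^-]$ for all $t,t^+,t^-$ as in 1. -/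

import Mathlib

namespace Triality

section Similitudes

variable {F V : Type*} [Field F] [AddCommGroup V] [Module F V]

/-- `t` is a similitude of the quadratic space `(V, q)` with multiplier `μ`. -/
def IsSimilitude (q : QuadraticForm F V) (t : V ≃ₗ[F] V) (μ : Fˣ) : Prop :=
  ∀ x, q (t x) = (μ : F) * q x

theorem IsSimilitude.one (q : QuadraticForm F V) : IsSimilitude q 1 1 := by
  intro x; simp

theorem IsSimilitude.mul {q : QuadraticForm F V} {s t : V ≃ₗ[F] V} {μ ν : Fˣ}
    (hs : IsSimilitude q s μ) (ht : IsSimilitude q t ν) : IsSimilitude q (s * t) (μ * ν) := by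
  intro x
  rw [LinearEquiv.mul_apply, hs, ht, Units.val_mul, mul_assoc]

theorem IsSimilitude.inv {q : QuadraticForm F V} {t : V ≃ₗ[F] V} {μ : Fˣ}
    (ht : IsSimilitude q t μ) : IsSimilitude q t⁻¹ μ⁻¹ := by
  intro x
  have h := ht (t⁻¹ x)
  rw [← LinearEquiv.mul_apply, mul_inv_cancel, LinearEquiv.coe_one, id] at h
  rw [h, ← mul_assoc, Units.inv_mul, one_mul]

/-- The pairing `(x, y) ↦ μ⁻¹ t(x) t(y)` with values in the even Clifford algebra. -/
def similitudeEvenHom {q : QuadraticForm F V} {t : V ≃ₗ[F] V} {μ : Fˣ}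
    (h : IsSimilitude q t μ) : CliffordAlgebra.EvenHom q (CliffordAlgebra.even q) where
  bilin := ((μ⁻¹ : Fˣ) : F) •
    (CliffordAlgebra.even.ι q).bilin.compl₁₂ (t : V →ₗ[F] V) (t : V →ₗ[F] V)
  contract m := by
    simp only [LinearMap.smul_apply, LinearMap.compl₁₂_apply, LinearEquiv.coe_coe]
    rw [(CliffordAlgebra.even.ι q).contract, h, ← algebraMap_smul (CliffordAlgebra.even q),
      smul_eq_mul, ← map_mul, ← mul_assoc, Units.inv_mul, one_mul]
  contract_mid m₁ m₂ m₃ := by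
    simp only [LinearMap.smul_apply, LinearMap.compl₁₂_apply, LinearEquiv.coe_coe]
    rw [smul_mul_smul_comm, (CliffordAlgebra.even.ι q).contract_mid, h, smul_smul, smul_smul]
    congr 1
    rw [mul_assoc, ← mul_assoc _ (μ : F), Units.inv_mul, one_mul, mul_comm]

/-- The endomorphism `C₀(t)` of the even Clifford algebra `C₀(q)` induced by a similitude `t`
with multiplier `μ`; it is determined by `C₀(t)(x y) = μ⁻¹ t(x) t(y)` for `x, y ∈ V`. -/
def evenMap {q : QuadraticForm F V} {t : V ≃ₗ[F] V} {μ : Fˣ} (h : IsSimilitude q t μ) :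
    CliffordAlgebra.even q →ₐ[F] CliffordAlgebra.even q :=
  CliffordAlgebra.even.lift q (similitudeEvenHom h)

theorem evenMap_ι {q : QuadraticForm F V} {t : V ≃ₗ[F] V} {μ : Fˣ} (h : IsSimilitude q t μ)
    (x y : V) :
    evenMap h ((CliffordAlgebra.even.ι q).bilin x y) =
      ((μ⁻¹ : Fˣ) : F) • (CliffordAlgebra.even.ι q).bilin (t x) (t y) := by
  rw [evenMap, CliffordAlgebra.even.lift_ι]
  rfl

/-- Two algebra endomorphisms of `C₀(q)` that agree on the products `x y` are equal. -/
theorem even_ext {q : QuadraticForm F V}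
    {f g : CliffordAlgebra.even q →ₐ[F] CliffordAlgebra.even q}
    (h : ∀ x y, f ((CliffordAlgebra.even.ι q).bilin x y) =
      g ((CliffordAlgebra.even.ι q).bilin x y)) : f = g :=
  CliffordAlgebra.even.algHom_ext q
    (CliffordAlgebra.EvenHom.ext (LinearMap.ext fun x => LinearMap.ext fun y => h x y))

theorem evenMap_eq_id {q : QuadraticForm F V} {t : V ≃ₗ[F] V} {μ : Fˣ} (h : IsSimilitude q t μ)
    (c : Fˣ) (hμ : μ = c * c) (ht : ∀ x, t x = (c : F) • x) :
    evenMap h = AlgHom.id F _ := by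
  refine even_ext fun x y => ?_
  rw [evenMap_ι, ht, ht, map_smul, map_smul, LinearMap.smul_apply, smul_smul, smul_smul,
    AlgHom.id_apply, ← Units.val_mul, ← Units.val_mul, hμ, mul_assoc, inv_mul_cancel,
    Units.val_one, one_smul]

theorem evenMap_mul {q : QuadraticForm F V} {s t : V ≃ₗ[F] V} {μ ν : Fˣ}
    (hs : IsSimilitude q s μ) (ht : IsSimilitude q t ν) :
    evenMap (hs.mul ht) = (evenMap hs).comp (evenMap ht) := by
  refine even_ext fun x y => ?_
  rw [AlgHom.comp_apply, evenMap_ι, evenMap_ι, map_smul, evenMap_ι, smul_smul,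
    LinearEquiv.mul_apply, LinearEquiv.mul_apply, mul_inv, Units.val_mul, mul_comm]

/-- The group `GO⁺(q)` of proper similitudes of `(V, q)`: the similitudes `t` for which `C₀(t)` is
the identity on the center of `C₀(q)`. (For a nonsingular `q` on a space of dimension `2m`, over a
field of characteristic different from `2`, this says `det t = μ(t) ^ m`.) -/
def GOPlus (q : QuadraticForm F V) : Subgroup (V ≃ₗ[F] V) where
  carrier := {t | ∃ (μ : Fˣ) (h : IsSimilitude q t μ),
    ∀ z ∈ Subalgebra.center F (CliffordAlgebra.even q), evenMap h z = z}
  one_mem' := ⟨1, IsSimilitude.one q, fun z _ => by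
    rw [evenMap_eq_id (IsSimilitude.one q) 1 (by simp) (by simp)]; rfl⟩
  mul_mem' := by
    rintro s t ⟨μ, hs, hs'⟩ ⟨ν, ht, ht'⟩
    refine ⟨μ * ν, hs.mul ht, fun z hz => ?_⟩
    rw [evenMap_mul hs ht, AlgHom.comp_apply, ht' z hz, hs' z hz]
  inv_mem' := by
    rintro t ⟨μ, ht, ht'⟩
    refine ⟨μ⁻¹, ht.inv, fun z hz => ?_⟩
    have h := evenMap_mul ht.inv ht
    rw [evenMap_eq_id (ht.inv.mul ht) 1 (by simp) (by simp)] at h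
    have h' := DFunLike.congr_fun h z
    rw [AlgHom.comp_apply, ht' z hz] at h'
    exact h'.symm

/-- The multiplier `μ(t)` of a proper similitude `t`. -/
noncomputable def multiplier {q : QuadraticForm F V} (t : GOPlus q) : Fˣ :=
  t.2.choose

theorem multiplier_spec {q : QuadraticForm F V} (t : GOPlus q) :
    IsSimilitude q (t : V ≃ₗ[F] V) (multiplier t) :=
  t.2.choose_spec.choose

/-- If `q` is not zero, the multiplier is determined by `q(t(x)) = μ(t) q(x)`. -/
theorem multiplier_unique {q : QuadraticForm F V} (hq : q ≠ 0) (t : GOPlus q) {μ : Fˣ}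
    (h : IsSimilitude q (t : V ≃ₗ[F] V) μ) : multiplier t = μ := by
  obtain ⟨x, hx⟩ : ∃ x, q x ≠ 0 := by
    by_contra! h0
    exact hq (QuadraticMap.ext h0)
  exact Units.ext (mul_right_cancel₀ hx ((multiplier_spec t x).symm.trans (h x)))

/-- The homomorphism that sends `c ∈ Fˣ` to the homothety `x ↦ c x`. -/
def homothety (q : QuadraticForm F V) : Fˣ →* GOPlus q :=
  (DistribMulAction.toModuleAut F V : Fˣ →* (V ≃ₗ[F] V)).codRestrict (GOPlus q) fun c => by
    have h : IsSimilitude q (DistribMulAction.toModuleAut F V c) (c * c) := fun x => by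
      rw [DistribMulAction.toModuleAut_apply, DistribMulAction.toLinearEquiv_apply,
        Units.smul_def, QuadraticMap.map_smul, smul_eq_mul, Units.val_mul]
    exact ⟨c * c, h, fun z _ => by rw [evenMap_eq_id h c rfl fun _ => rfl]; rfl⟩

instance homothety_range_normal (q : QuadraticForm F V) : (homothety q).range.Normal where
  conj_mem := by
    rintro _ ⟨c, rfl⟩ g
    refine ⟨c, ?_⟩
    rw [eq_mul_inv_iff_mul_eq]
    refine Subtype.ext (LinearEquiv.ext fun x => ?_)
    exact ((g : V ≃ₗ[F] V).map_smul (c : F) x).symm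

/-- `PGO⁺(q) = GO⁺(q) / Fˣ`. -/
abbrev PGOPlus (q : QuadraticForm F V) : Type _ :=
  GOPlus q ⧸ (homothety q).range

/-- The class `[t]` in `PGO⁺(q)` of a proper similitude `t`. -/
def cls {q : QuadraticForm F V} (t : GOPlus q) : PGOPlus q :=
  QuotientGroup.mk t

end Similitudes

section Cayley

variable {F O : Type*} [Field F] [NonAssocRing O] [Module F O]

/-- The unital `F`-algebra `O` is a Cayley algebra with norm form `n`: it has dimension `8`, and
`n` is a nonsingular multiplicative quadratic form. -/
structure IsCayleyAlgebra [IsScalarTower F O O] [SMulCommClass F O O]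
    (n : QuadraticForm F O) : Prop where
  finrank_eq : Module.finrank F O = 8
  nonsingular : n.polarBilin.Nondegenerate
  map_mul : ∀ x y : O, n (x * y) = n x * n y

/-- The conjugation `x̄ = b(x, 1) 1 - x`, where `b` is the polar form of `n`. -/
def conj (n : QuadraticForm F O) (x : O) : O :=
  QuadraticMap.polar n x 1 • (1 : O) - x

/-- The para-Cayley product `x ⋆ y = x̄ ȳ`. -/
def paraCayley (n : QuadraticForm F O) (x y : O) : O :=
  conj n x * conj n y

/-- The three triality relations
`t⁺(x ⋆ y) = μ(t⁺) t(x) ⋆ t⁻(y)`, `t(x ⋆ y) = μ(t) t⁻(x) ⋆ t⁺(y)`,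
`t⁻(x ⋆ y) = μ(t⁻) t⁺(x) ⋆ t(y)`. -/
structure TrialityRelations (n : QuadraticForm F O) (t tp tm : GOPlus n) : Prop where
  rel_a : ∀ x y : O, tp.1 (paraCayley n x y) =
    (multiplier tp : F) • paraCayley n (t.1 x) (tm.1 y)
  rel_b : ∀ x y : O, t.1 (paraCayley n x y) =
    (multiplier t : F) • paraCayley n (tm.1 x) (tp.1 y)
  rel_c : ∀ x y : O, tm.1 (paraCayley n x y) =
    (multiplier tm : F) • paraCayley n (tp.1 x) (t.1 y)

end Cayley

/-- The `3`-cycle `0 ↦ 1 ↦ 2 ↦ 0`, a generator of `A₃`. -/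
def threeCycle : alternatingGroup (Fin 3) :=
  ⟨finRotate 3, Equiv.Perm.mem_alternatingGroup.2 (by decide)⟩

end Triality

/-! The operators `(a, b) ↦ (x ⋆ b, a ⋆ x)` on `O × O` square to `n x`, because `(x ⋆ y) ⋆ x = x ⋆
(y ⋆ x) = n(x) y`. They therefore extend to a representation of the Clifford algebra. It is
injective (`cliffordAlgebra_hom_injective`), hence bijective since `2 ^ 8 = 16 ^ 2`. Even elements
act diagonally, so `C₀(n) ≃ End O × End O` through the two half-spin representations
(`spin_injective`, `spin_surjective`).

If `t` is proper, `C₀(t)` fixes the central idempotents and hence preserves each factor. By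
Skolem–Noether it acts on the first one as conjugation by some `g` (`exists_conj_spinPlus`).
Evaluated on products `x y`, this says that `g`, together with a companion map obtained from it,
satisfies (a) and (c) after rescaling; (b) follows from associativity of the polar form for `⋆`
(`exists_isTriple`).

Conversely, in any triple of similitudes satisfying the relations, `t⁺` and `t⁻` implement `C₀(t)`
on the two factors (`spinPlus_evenMap`, `spinMinus_evenMap`). Thus `t` is proper, and `t⁺` is
determined up to a scalar because its conjugation is. The relations are invariant under cyclic
rotation of `(t, t⁺, t⁻)`, so `t⁺` and `t⁻` are proper too and `[t] ↦ [t⁺]` has cube `1`. -/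

namespace Triality

/-! ### Dimension of Clifford algebras and injectivity of their representations, in any
characteristic -/

section CliffordDimension

open CliffordAlgebra

variable {F V J : Type*} [Field F] [AddCommGroup V] [Module F V] (Q : QuadraticForm F V)

/-- The subalgebra of the Clifford algebra generated by the vectors `v j` with `j ∈ S`. -/
def cliffordAdjoin (v : J → V) (S : Set J) : Subalgebra F (CliffordAlgebra Q) :=
  Algebra.adjoin F ((fun j => ι Q (v j)) '' S)

variable {Q}

theorem ι_mem_cliffordAdjoin (v : J → V) {S : Set J} {j : J} (hj : j ∈ S) :
    ι Q (v j) ∈ cliffordAdjoin Q v S :=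
  Algebra.subset_adjoin ⟨j, hj, rfl⟩

/-- Contraction by `d` passes each generator killed by `d` at the cost of a sign, so it passes `x`
at the cost of `involute`; then apply it to `x * 1`. -/
theorem contractLeft_eq_zero_of_mem_cliffordAdjoin {v : J → V} {S : Set J} {d : Module.Dual F V}
    (hd : ∀ j ∈ S, d (v j) = 0) {x : CliffordAlgebra Q} (hx : x ∈ cliffordAdjoin Q v S) :
    contractLeft d x = 0 := by
  have key : ∀ y, contractLeft d (x * y) = involute x * contractLeft d y := by
    induction hx using Algebra.adjoin_induction with
    | mem x hx =>
      obtain ⟨j, hj, rfl⟩ := hx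
      intro y
      rw [contractLeft_ι_mul, hd j hj, zero_smul, zero_sub, involute_ι, neg_mul]
    | algebraMap r => intro y; rw [contractLeft_algebraMap_mul, AlgHom.commutes]
    | add x y _ _ hx hy => intro z; rw [add_mul, map_add, hx, hy, map_add, add_mul]
    | mul x y _ _ hx hy => intro z; rw [mul_assoc, hx, hy, map_mul, mul_assoc]
  simpa using key 1

/-- Elements of this form are stable under left multiplication by the generators: `v i` exchanges
the two coefficients up to `Q (v i)`, and any other `v j` moves past `v i` with a scalar correction.
-/
theorem exists_eq_add_ι_mul_of_mem_cliffordAdjoin_insert (v : J → V) (S : Set J) (i : J)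
    {x : CliffordAlgebra Q} (hx : x ∈ cliffordAdjoin Q v (insert i S)) :
    ∃ a ∈ cliffordAdjoin Q v S, ∃ c ∈ cliffordAdjoin Q v S, x = a + ι Q (v i) * c := by
  have key : ∀ a ∈ cliffordAdjoin Q v S, ∀ c ∈ cliffordAdjoin Q v S,
      ∃ a' ∈ cliffordAdjoin Q v S, ∃ c' ∈ cliffordAdjoin Q v S,
        x * (a + ι Q (v i) * c) = a' + ι Q (v i) * c' := by
    induction hx using Algebra.adjoin_induction with
    | mem x hx =>
      obtain ⟨j, rfl | hj, rfl⟩ := hx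
      · intro a ha c hc
        refine ⟨Q (v j) • c, Subalgebra.smul_mem _ hc _, a, ha, ?_⟩
        dsimp only
        rw [mul_add, ← mul_assoc, ι_sq_scalar, Algebra.smul_def, add_comm]
      · intro a ha c hc
        have hj' := ι_mem_cliffordAdjoin (Q := Q) v hj
        refine ⟨ι Q (v j) * a + QuadraticMap.polar Q (v j) (v i) • c,
          add_mem (mul_mem hj' ha) (Subalgebra.smul_mem _ hc _),
          -(ι Q (v j) * c), neg_mem (mul_mem hj' hc), ?_⟩
        have h := ι_mul_ι_add_swap (Q := Q) (v j) (v i)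
        dsimp only
        rw [Algebra.smul_def, ← h]
        noncomm_ring
    | algebraMap r =>
      intro a ha c hc
      refine ⟨r • a, Subalgebra.smul_mem _ ha _, r • c, Subalgebra.smul_mem _ hc _, ?_⟩
      rw [← Algebra.smul_def, smul_add, mul_smul_comm]
    | add x y _ _ hx hy =>
      intro a ha c hc
      obtain ⟨a₁, ha₁, c₁, hc₁, h₁⟩ := hx a ha c hc
      obtain ⟨a₂, ha₂, c₂, hc₂, h₂⟩ := hy a ha c hc
      refine ⟨a₁ + a₂, add_mem ha₁ ha₂, c₁ + c₂, add_mem hc₁ hc₂, ?_⟩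
      rw [add_mul, h₁, h₂, mul_add]
      abel
    | mul x y _ _ hx hy =>
      intro a ha c hc
      obtain ⟨a₁, ha₁, c₁, hc₁, h₁⟩ := hy a ha c hc
      rw [mul_assoc, h₁]
      exact hx a₁ ha₁ c₁ hc₁
  simpa using key 1 (one_mem _) 0 (zero_mem _)

/-- Contraction reads off the coefficient `c`, which makes the normal form unique and lets the
kernel of a homomorphism be peeled one basis vector at a time. -/
theorem contractLeft_add_ι_mul {v : J → V} {S : Set J} {i : J} {d : Module.Dual F V}
    (hi : d (v i) = 1) (hd : ∀ j ∈ S, d (v j) = 0) {a c : CliffordAlgebra Q}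
    (ha : a ∈ cliffordAdjoin Q v S) (hc : c ∈ cliffordAdjoin Q v S) :
    contractLeft d (a + ι Q (v i) * c) = c := by
  rw [map_add, contractLeft_ι_mul, hi, contractLeft_eq_zero_of_mem_cliffordAdjoin hd ha,
    contractLeft_eq_zero_of_mem_cliffordAdjoin hd hc, one_smul, mul_zero, sub_zero, zero_add]

theorem cliffordAdjoin_mono (v : J → V) {S T : Set J} (h : S ⊆ T) :
    cliffordAdjoin Q v S ≤ cliffordAdjoin Q v T :=
  Algebra.adjoin_mono (Set.image_mono h)

theorem cliffordAdjoin_empty (v : J → V) : cliffordAdjoin Q v ∅ = ⊥ := by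
  rw [cliffordAdjoin, Set.image_empty, Algebra.adjoin_empty]

theorem cliffordAdjoin_univ (b : Module.Basis J F V) : cliffordAdjoin Q b Set.univ = ⊤ := by
  refine top_unique ?_
  rw [← CliffordAlgebra.adjoin_range_ι, Algebra.adjoin_le_iff]
  rintro _ ⟨x, rfl⟩
  have hx : x ∈ Submodule.span F (Set.range b) := by rw [b.span_eq]; trivial
  induction hx using Submodule.span_induction with
  | mem x hx =>
    obtain ⟨j, rfl⟩ := hx
    exact ι_mem_cliffordAdjoin _ (Set.mem_univ j)
  | zero => rw [map_zero]; exact zero_mem _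
  | add x y _ _ hx hy => rw [map_add]; exact add_mem hx hy
  | smul c x _ hx => rw [map_smul]; exact Subalgebra.smul_mem _ hx c

/-- The map `(a, c) ↦ a + v i * c`, which is bijective if `i ∉ S`. -/
def cliffordAdjoinInsert (v : J → V) (S : Set J) (i : J) :
    (cliffordAdjoin Q v S × cliffordAdjoin Q v S) →ₗ[F] cliffordAdjoin Q v (insert i S) where
  toFun p := ⟨p.1 + ι Q (v i) * p.2, add_mem (cliffordAdjoin_mono v (Set.subset_insert i S) p.1.2)
    (mul_mem (ι_mem_cliffordAdjoin v (Set.mem_insert i S))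
      (cliffordAdjoin_mono v (Set.subset_insert i S) p.2.2))⟩
  map_add' p q := Subtype.ext (by
    simp only [Prod.fst_add, Prod.snd_add, Subalgebra.coe_add]; noncomm_ring)
  map_smul' r p := Subtype.ext (by simp [smul_add])

theorem cliffordAdjoinInsert_bijective {v : J → V} {S : Set J} {i : J} {d : Module.Dual F V}
    (hi : d (v i) = 1) (hd : ∀ j ∈ S, d (v j) = 0) :
    Function.Bijective (cliffordAdjoinInsert (Q := Q) v S i) := by
  constructor
  · rw [← LinearMap.ker_eq_bot, LinearMap.ker_eq_bot']
    rintro ⟨⟨a, ha⟩, ⟨c, hc⟩⟩ h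
    have h' : a + ι Q (v i) * c = 0 := congrArg Subtype.val h
    have h2 := contractLeft_add_ι_mul hi hd ha hc
    rw [h', map_zero] at h2
    subst h2
    rw [mul_zero, add_zero] at h'
    subst h'
    rfl
  · rintro ⟨x, hx⟩
    obtain ⟨a, ha, c, hc, rfl⟩ := exists_eq_add_ι_mul_of_mem_cliffordAdjoin_insert v S i hx
    exact ⟨(⟨a, ha⟩, ⟨c, hc⟩), rfl⟩

theorem finrank_cliffordAdjoin [Nontrivial (CliffordAlgebra Q)] (b : Module.Basis J F V)
    (S : Finset J) :
    Module.Finite F (cliffordAdjoin Q b S) ∧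
      Module.finrank F (cliffordAdjoin Q b S) = 2 ^ S.card := by
  classical
  induction S using Finset.induction_on with
  | empty =>
    rw [Finset.coe_empty, cliffordAdjoin_empty, Finset.card_empty, pow_zero]
    exact ⟨inferInstance, Subalgebra.finrank_bot⟩
  | insert i S hi ih =>
    obtain ⟨h1, h2⟩ := ih
    have hbij := cliffordAdjoinInsert_bijective (Q := Q) (v := b) (S := (S : Set J)) (i := i)
      (d := b.coord i) (by simp) (fun j hj => by
        rw [b.coord_apply, b.repr_self, Finsupp.single_eq_of_ne]
        rintro rfl; exact hi hj)
    let e := LinearEquiv.ofBijective _ hbij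
    rw [Finset.coe_insert]
    refine ⟨Module.Finite.equiv e, ?_⟩
    rw [← e.finrank_eq, Module.finrank_prod, h2, Finset.card_insert_of_notMem hi, pow_succ]
    ring

theorem finite_cliffordAlgebra [Module.Finite F V] (Q : QuadraticForm F V)
    [Nontrivial (CliffordAlgebra Q)] :
    Module.Finite F (CliffordAlgebra Q) := by
  have h := (finrank_cliffordAdjoin (Q := Q) (Module.finBasis F V) Finset.univ).1
  rw [Finset.coe_univ, cliffordAdjoin_univ] at h
  exact Module.Finite.equiv (Subalgebra.topEquiv (R := F) (A := CliffordAlgebra Q)).toLinearEquiv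

theorem finrank_cliffordAlgebra [Module.Finite F V] (Q : QuadraticForm F V)
    [Nontrivial (CliffordAlgebra Q)] :
    Module.finrank F (CliffordAlgebra Q) = 2 ^ Module.finrank F V := by
  have h := (finrank_cliffordAdjoin (Q := Q) (Module.finBasis F V) Finset.univ).2
  rw [Finset.coe_univ, cliffordAdjoin_univ, Finset.card_univ, Fintype.card_fin] at h
  rw [← h, (Subalgebra.topEquiv (R := F) (A := CliffordAlgebra Q)).toLinearEquiv.finrank_eq]

/-- Contraction by `b(v, ·)` is the graded commutator with `v`, so ideals stable under `involute`
are stable under it. -/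
theorem contractLeft_polarBilin (v : V) (x : CliffordAlgebra Q) :
    contractLeft (Q.polarBilin v) x = ι Q v * x - involute x * ι Q v := by
  induction x using CliffordAlgebra.left_induction with
  | algebraMap r =>
    rw [contractLeft_algebraMap, AlgHom.commutes, Algebra.commutes, sub_self]
  | add x y hx hy => rw [map_add, hx, hy, map_add]; noncomm_ring
  | ι_mul x m hx =>
    have h := ι_mul_ι_add_swap (Q := Q) v m
    rw [contractLeft_ι_mul, hx, map_mul, involute_ι, QuadraticMap.polarBilin_apply_apply,
      Algebra.smul_def, ← h]
    noncomm_ring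

/-- A homomorphism from the Clifford algebra of a nonsingular quadratic form to a nonzero algebra
is injective if its kernel is stable under the grade involution. -/
theorem cliffordAlgebra_hom_injective [Module.Finite F V] {A : Type*} [Ring A] [Algebra F A]
    [Nontrivial A] (hQ : Q.polarBilin.Nondegenerate) (f : CliffordAlgebra Q →ₐ[F] A)
    (hf : ∀ x, f x = 0 → f (involute x) = 0) : Function.Injective f := by
  classical
  -- Nonsingularity makes every functional a `b(v, ·)`, so the kernel of `f` is closed under all
  -- contractions.
  have hsurj : ∀ d : Module.Dual F V, ∃ v, Q.polarBilin v = d := fun d => by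
    have hker : LinearMap.ker Q.polarBilin = ⊥ :=
      LinearMap.separatingLeft_iff_ker_eq_bot.1 hQ.1
    exact (LinearMap.injective_iff_surjective_of_finrank_eq_finrank
      (Subspace.dual_finrank_eq).symm).1 (LinearMap.ker_eq_bot.1 hker) d
  have hclosed : ∀ d : Module.Dual F V, ∀ x, f x = 0 → f (contractLeft d x) = 0 := by
    intro d x hx
    obtain ⟨v, rfl⟩ := hsurj d
    rw [contractLeft_polarBilin, map_sub, map_mul, map_mul, hx, hf x hx, mul_zero, zero_mul,
      sub_zero]
  let b := Module.finBasis F V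
  have key : ∀ S : Finset (Fin (Module.finrank F V)), ∀ x ∈ cliffordAdjoin Q b S,
      f x = 0 → x = 0 := by
    intro S
    induction S using Finset.induction_on with
    | empty =>
      intro x hx hfx
      rw [Finset.coe_empty, cliffordAdjoin_empty, Algebra.mem_bot] at hx
      obtain ⟨r, rfl⟩ := hx
      rw [AlgHom.commutes] at hfx
      rw [(map_eq_zero_iff _ (algebraMap F A).injective).1 hfx, map_zero]
    | insert i S hi ih =>
      intro x hx hfx
      rw [Finset.coe_insert] at hx
      obtain ⟨a, ha, c, hc, rfl⟩ := exists_eq_add_ι_mul_of_mem_cliffordAdjoin_insert b S i hx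
      have h := contractLeft_add_ι_mul (v := b) (i := i) (d := b.coord i) (by simp) (fun j hj => by
        rw [b.coord_apply, b.repr_self, Finsupp.single_eq_of_ne]
        rintro rfl; exact hi hj) ha hc
      have hc0 : c = 0 := ih c hc (by rw [← h]; exact hclosed _ _ hfx)
      rw [hc0, mul_zero, add_zero] at hfx ⊢
      exact ih a ha hfx
  refine (injective_iff_map_eq_zero f).2 fun x hx => key Finset.univ x ?_ hx
  rw [Finset.coe_univ, cliffordAdjoin_univ]
  trivial

end CliffordDimension

/-! ### Composition identities for the norm and the para-Cayley product -/

section CayleyIdentities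

variable {F O : Type*} [Field F] [NonAssocRing O] [Module F O]

/-- The conjugation as a linear map. -/
def conjLinear (n : QuadraticForm F O) : O →ₗ[F] O :=
  (n.polarBilin.flip 1).smulRight (1 : O) - LinearMap.id

variable [IsScalarTower F O O] [SMulCommClass F O O] {n : QuadraticForm F O}

namespace IsCayleyAlgebra

theorem finite (hO : IsCayleyAlgebra n) : Module.Finite F O :=
  Module.finite_of_finrank_pos (by rw [hO.finrank_eq]; norm_num)

theorem ne_zero (hO : IsCayleyAlgebra n) : n ≠ 0 := by
  rintro rfl
  have : Nontrivial O := Module.nontrivial_of_finrank_pos (R := F) (by rw [hO.finrank_eq]; norm_num)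
  obtain ⟨x, hx⟩ := exists_ne (0 : O)
  exact hx (hO.nonsingular.1 x fun y => by simp [QuadraticMap.polar])

theorem norm_one (hO : IsCayleyAlgebra n) : n 1 = 1 := by
  obtain ⟨x, hx⟩ : ∃ x, n x ≠ 0 := by
    by_contra! h0
    exact hO.ne_zero (QuadraticMap.ext h0)
  have h := hO.map_mul x 1
  rw [mul_one] at h
  exact (mul_eq_left₀ hx).1 h.symm

theorem ext_polar (hO : IsCayleyAlgebra n) {x y : O}
    (h : ∀ z, QuadraticMap.polar n x z = QuadraticMap.polar n y z) : x = y := by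
  rw [← sub_eq_zero]
  refine hO.nonsingular.1 _ fun z => ?_
  rw [QuadraticMap.polarBilin_apply_apply, QuadraticMap.polar_sub_left, h, sub_self]

theorem polar_mul_mul_left (hO : IsCayleyAlgebra n) (x y z : O) :
    QuadraticMap.polar n (x * y) (x * z) = n x * QuadraticMap.polar n y z := by
  simp only [QuadraticMap.polar, ← mul_add, hO.map_mul]
  ring

theorem polar_mul_mul_right (hO : IsCayleyAlgebra n) (x y z : O) :
    QuadraticMap.polar n (y * x) (z * x) = QuadraticMap.polar n y z * n x := by
  simp only [QuadraticMap.polar, ← add_mul, hO.map_mul]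
  ring

theorem polar_mul_mul_add (hO : IsCayleyAlgebra n) (x y z w : O) :
    QuadraticMap.polar n (x * y) (w * z) + QuadraticMap.polar n (w * y) (x * z) =
      QuadraticMap.polar n x w * QuadraticMap.polar n y z := by
  have h := hO.polar_mul_mul_left (x + w) y z
  rw [add_mul, add_mul, QuadraticMap.polar_add_left, QuadraticMap.polar_add_right,
    QuadraticMap.polar_add_right, hO.polar_mul_mul_left, hO.polar_mul_mul_left] at h
  have h2 : n (x + w) = n x + n w + QuadraticMap.polar n x w := by
    simp only [QuadraticMap.polar]; ring
  rw [h2] at h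
  linear_combination h

/-- Linearizing `n(xy) = n(x) n(y)` and setting one variable to `1` shows that left multiplication
by `x̄` is adjoint to that by `x`. The identities below follow by pairing with a test vector. -/
theorem polar_mul_left (hO : IsCayleyAlgebra n) (x y z : O) :
    QuadraticMap.polar n (x * y) z = QuadraticMap.polar n y (conj n x * z) := by
  have h := hO.polar_mul_mul_add x y z 1
  rw [one_mul, one_mul] at h
  rw [conj, sub_mul, smul_mul_assoc, one_mul, QuadraticMap.polar_sub_right,
    QuadraticMap.polar_smul_right, smul_eq_mul]
  linear_combination h

theorem polar_mul_right (hO : IsCayleyAlgebra n) (x y z : O) :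
    QuadraticMap.polar n (y * x) z = QuadraticMap.polar n y (z * conj n x) := by
  have h := hO.polar_mul_mul_add y x 1 z
  rw [mul_one, mul_one] at h
  rw [conj, mul_sub, mul_smul_comm, mul_one, QuadraticMap.polar_sub_right,
    QuadraticMap.polar_smul_right, smul_eq_mul, QuadraticMap.polar_comm n y (z * x)]
  linear_combination h

theorem polar_one_one (hO : IsCayleyAlgebra n) : QuadraticMap.polar n 1 1 = 2 := by
  rw [QuadraticMap.polar_self, hO.norm_one]; simp

theorem conj_one (hO : IsCayleyAlgebra n) : conj n (1 : O) = 1 := by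
  rw [conj, hO.polar_one_one, two_smul, add_sub_cancel_right]

theorem polar_conj_conj (hO : IsCayleyAlgebra n) (x y : O) :
    QuadraticMap.polar n (conj n x) (conj n y) = QuadraticMap.polar n x y := by
  simp only [conj, QuadraticMap.polar_sub_left, QuadraticMap.polar_sub_right,
    QuadraticMap.polar_smul_left, QuadraticMap.polar_smul_right, hO.polar_one_one, smul_eq_mul,
    QuadraticMap.polar_comm n 1 y]
  ring

theorem conj_conj (hO : IsCayleyAlgebra n) (x : O) : conj n (conj n x) = x := by
  simp only [conj, QuadraticMap.polar_sub_left, QuadraticMap.polar_smul_left, hO.polar_one_one,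
    smul_eq_mul]
  rw [mul_two, add_sub_cancel_right, sub_sub_cancel]

theorem norm_conj (hO : IsCayleyAlgebra n) (x : O) : n (conj n x) = n x := by
  rw [conj, sub_eq_add_neg, QuadraticMap.map_add n, QuadraticMap.map_smul, QuadraticMap.map_neg,
    QuadraticMap.polar_smul_left, QuadraticMap.polar_neg_right, hO.norm_one,
    QuadraticMap.polar_comm n 1 x, smul_eq_mul, smul_eq_mul]
  ring

theorem polar_conj_left (hO : IsCayleyAlgebra n) (x y : O) :
    QuadraticMap.polar n (conj n x) y = QuadraticMap.polar n x (conj n y) := by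
  rw [← hO.polar_conj_conj, hO.conj_conj]

theorem conj_mul (hO : IsCayleyAlgebra n) (x y : O) : conj n (x * y) = conj n y * conj n x := by
  refine hO.ext_polar fun z => ?_
  rw [hO.polar_conj_left, hO.polar_mul_right, ← hO.polar_mul_left, hO.polar_mul_right,
    QuadraticMap.polar_comm]

theorem conj_mul_mul_cancel (hO : IsCayleyAlgebra n) (x y : O) :
    conj n x * (x * y) = n x • y := by
  refine hO.ext_polar fun z => ?_
  rw [hO.polar_mul_left, hO.conj_conj, hO.polar_mul_mul_left, QuadraticMap.polar_smul_left,
    smul_eq_mul]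

theorem mul_mul_conj_cancel (hO : IsCayleyAlgebra n) (x y : O) :
    (y * x) * conj n x = n x • y := by
  refine hO.ext_polar fun z => ?_
  rw [hO.polar_mul_right, hO.conj_conj, hO.polar_mul_mul_right, QuadraticMap.polar_smul_left,
    smul_eq_mul, mul_comm]

theorem norm_paraCayley (hO : IsCayleyAlgebra n) (x y : O) :
    n (paraCayley n x y) = n x * n y := by
  rw [paraCayley, hO.map_mul, hO.norm_conj, hO.norm_conj]

theorem paraCayley_paraCayley_left (hO : IsCayleyAlgebra n) (x y : O) :
    paraCayley n (paraCayley n x y) x = n x • y := by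
  rw [paraCayley, paraCayley, hO.conj_mul, hO.conj_conj, hO.conj_conj, hO.mul_mul_conj_cancel]

theorem paraCayley_paraCayley_right (hO : IsCayleyAlgebra n) (x y : O) :
    paraCayley n x (paraCayley n y x) = n x • y := by
  rw [paraCayley, paraCayley, hO.conj_mul, hO.conj_conj, hO.conj_conj, hO.conj_mul_mul_cancel]

/-- This cyclic invariance is what yields the second triality relation from the first. -/
theorem polar_paraCayley (hO : IsCayleyAlgebra n) (x y z : O) :
    QuadraticMap.polar n (paraCayley n x y) z = QuadraticMap.polar n x (paraCayley n y z) := by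
  rw [paraCayley, paraCayley, hO.polar_mul_right, hO.conj_conj, hO.polar_conj_left, hO.conj_mul]

end IsCayleyAlgebra

end CayleyIdentities

/-! ### The Clifford algebra as `End (O × O)` and the half-spin representations -/

section Representation

open CliffordAlgebra

variable {F O : Type*} [Field F] [NonAssocRing O] [Module F O]
  [IsScalarTower F O O] [SMulCommClass F O O]

/-- The para-Cayley product as a bilinear map. -/
def paraCayleyBilin (n : QuadraticForm F O) : O →ₗ[F] O →ₗ[F] O :=
  (LinearMap.mul F O).compl₁₂ (conjLinear n) (conjLinear n)

@[simp]
theorem paraCayleyBilin_apply (n : QuadraticForm F O) (x y : O) :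
    paraCayleyBilin n x y = paraCayley n x y := rfl

@[simp]
theorem paraCayleyBilin_flip_apply (n : QuadraticForm F O) (x y : O) :
    (paraCayleyBilin n).flip x y = paraCayley n y x := rfl

@[simp]
theorem paraCayley_zero (n : QuadraticForm F O) (x : O) : paraCayley n x 0 = 0 :=
  map_zero (paraCayleyBilin n x)

@[simp]
theorem zero_paraCayley (n : QuadraticForm F O) (x : O) : paraCayley n 0 x = 0 :=
  map_zero ((paraCayleyBilin n).flip x)

theorem paraCayley_smul (n : QuadraticForm F O) (c : F) (x y : O) :
    paraCayley n x (c • y) = c • paraCayley n x y :=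
  map_smul (paraCayleyBilin n x) c y

theorem smul_paraCayley (n : QuadraticForm F O) (c : F) (x y : O) :
    paraCayley n (c • x) y = c • paraCayley n x y :=
  map_smul ((paraCayleyBilin n).flip y) c x

/-- The operator `(a, b) ↦ (x ⋆ b, a ⋆ x)` on `O × O`. -/
def cliffordGenerator (n : QuadraticForm F O) : O →ₗ[F] Module.End F (O × O) :=
  LinearMap.mk₂ F (fun x p => (paraCayleyBilin n x p.2, (paraCayleyBilin n).flip x p.1))
    (fun _ _ _ => by simp only [map_add, LinearMap.add_apply, Prod.mk_add_mk])
    (fun _ _ _ => by simp only [map_smul, LinearMap.smul_apply, Prod.smul_mk])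
    (fun _ _ _ => by simp only [Prod.fst_add, Prod.snd_add, map_add, Prod.mk_add_mk])
    (fun _ _ _ => by simp only [Prod.smul_fst, Prod.smul_snd, map_smul, Prod.smul_mk])

@[simp]
theorem cliffordGenerator_apply (n : QuadraticForm F O) (x : O) (p : O × O) :
    cliffordGenerator n x p = (paraCayley n x p.2, paraCayley n p.1 x) := rfl

variable {n : QuadraticForm F O}

namespace IsCayleyAlgebra

/-- The representation of the Clifford algebra of `n` on `O × O` given by the para-Cayley
product. -/
def cliffordRep (hO : IsCayleyAlgebra n) : CliffordAlgebra n →ₐ[F] Module.End F (O × O) :=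
  CliffordAlgebra.lift n ⟨cliffordGenerator n, fun x => LinearMap.ext fun p => by
    rw [Module.End.mul_apply, cliffordGenerator_apply, cliffordGenerator_apply,
      hO.paraCayley_paraCayley_left, hO.paraCayley_paraCayley_right,
      Module.algebraMap_end_apply]
    rfl⟩

theorem cliffordRep_ι (hO : IsCayleyAlgebra n) (x : O) :
    hO.cliffordRep (ι n x) = cliffordGenerator n x :=
  CliffordAlgebra.lift_ι_apply _ _ _

/-- The half-spin representation `x y ↦ (a ↦ x ⋆ (a ⋆ y))` of the even Clifford algebra. -/
def spinPlus (hO : IsCayleyAlgebra n) : even n →ₐ[F] Module.End F O :=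
  even.lift n
    { bilin := (LinearMap.mul F (Module.End F O)).compl₁₂ (paraCayleyBilin n)
        (paraCayleyBilin n).flip
      contract := fun x => LinearMap.ext fun y => hO.paraCayley_paraCayley_right x y
      contract_mid := fun x y z => LinearMap.ext fun a => by
        change paraCayley n x (paraCayley n (paraCayley n y (paraCayley n a z)) y) =
          n y • paraCayley n x (paraCayley n a z)
        rw [hO.paraCayley_paraCayley_left, ← paraCayleyBilin_apply, map_smul,
          paraCayleyBilin_apply] }

/-- The half-spin representation `x y ↦ (a ↦ (y ⋆ a) ⋆ x)` of the even Clifford algebra. -/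
def spinMinus (hO : IsCayleyAlgebra n) : even n →ₐ[F] Module.End F O :=
  even.lift n
    { bilin := (LinearMap.mul F (Module.End F O)).compl₁₂ (paraCayleyBilin n).flip
        (paraCayleyBilin n)
      contract := fun x => LinearMap.ext fun y => hO.paraCayley_paraCayley_left x y
      contract_mid := fun x y z => LinearMap.ext fun a => by
        change paraCayley n (paraCayley n y (paraCayley n (paraCayley n z a) y)) x =
          n y • paraCayley n (paraCayley n z a) x
        rw [hO.paraCayley_paraCayley_right, ← paraCayleyBilin_flip_apply, map_smul,
          paraCayleyBilin_flip_apply] }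

theorem spinPlus_ι (hO : IsCayleyAlgebra n) (x y a : O) :
    hO.spinPlus ((even.ι n).bilin x y) a = paraCayley n x (paraCayley n a y) := by
  rw [spinPlus, even.lift_ι]; rfl

theorem spinMinus_ι (hO : IsCayleyAlgebra n) (x y a : O) :
    hO.spinMinus ((even.ι n).bilin x y) a = paraCayley n (paraCayley n y a) x := by
  rw [spinMinus, even.lift_ι]; rfl

theorem cliffordRep_even (hO : IsCayleyAlgebra n) (c : even n) :
    hO.cliffordRep c = (hO.spinPlus c).prodMap (hO.spinMinus c) := by
  have h : hO.cliffordRep.comp (even n).val =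
      (LinearMap.prodMapAlgHom F O O).comp (hO.spinPlus.prod hO.spinMinus) := by
    refine even.algHom_ext n (EvenHom.ext (LinearMap.ext fun x => LinearMap.ext fun y =>
      LinearMap.ext fun p => ?_))
    change hO.cliffordRep (ι n x * ι n y) p = (hO.spinPlus ((even.ι n).bilin x y) p.1,
      hO.spinMinus ((even.ι n).bilin x y) p.2)
    rw [_root_.map_mul, hO.cliffordRep_ι, hO.cliffordRep_ι, hO.spinPlus_ι, hO.spinMinus_ι,
      Module.End.mul_apply]
    rfl
  exact DFunLike.congr_fun h c

/-- The grading operator `diag(1, -1)` anticommutes with every vector operator, so it implements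
`involute`; this makes the kernel of the representation stable under `involute`. -/
theorem cliffordRep_involute (hO : IsCayleyAlgebra n) (x : CliffordAlgebra n) :
    hO.cliffordRep (involute x) * (LinearMap.id : O →ₗ[F] O).prodMap (-LinearMap.id) =
      (LinearMap.id : O →ₗ[F] O).prodMap (-LinearMap.id) * hO.cliffordRep x := by
  induction x using CliffordAlgebra.induction with
  | algebraMap r => rw [AlgHom.commutes, AlgHom.commutes, Algebra.commutes]
  | ι x =>
    rw [involute_ι, map_neg, hO.cliffordRep_ι]
    refine LinearMap.ext fun p => ?_
    change -(paraCayleyBilin n x (-p.2), paraCayley n p.1 x) =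
      (paraCayley n x p.2, -paraCayley n p.1 x)
    rw [map_neg, paraCayleyBilin_apply, Prod.neg_mk, neg_neg]
  | mul x y hx hy => rw [_root_.map_mul, _root_.map_mul, _root_.map_mul, mul_assoc, hy,
    ← mul_assoc, hx, mul_assoc]
  | add x y hx hy => rw [map_add, map_add, map_add, add_mul, hx, hy, mul_add]

theorem cliffordRep_injective (hO : IsCayleyAlgebra n) : Function.Injective hO.cliffordRep := by
  have := hO.finite
  have : Nontrivial O := Module.nontrivial_of_finrank_pos (R := F) (by rw [hO.finrank_eq]; norm_num)
  refine cliffordAlgebra_hom_injective hO.nonsingular _ fun x hx => ?_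
  have h := hO.cliffordRep_involute x
  rw [hx, mul_zero] at h
  refine LinearMap.ext fun p => ?_
  have h' := LinearMap.congr_fun h (p.1, -p.2)
  simpa using h'

theorem cliffordRep_surjective (hO : IsCayleyAlgebra n) : Function.Surjective hO.cliffordRep := by
  have := hO.finite
  have : Nontrivial O := Module.nontrivial_of_finrank_pos (R := F) (by rw [hO.finrank_eq]; norm_num)
  have : Nontrivial (CliffordAlgebra n) := hO.cliffordRep.toRingHom.domain_nontrivial
  have := finite_cliffordAlgebra n
  refine (LinearMap.injective_iff_surjective_of_finrank_eq_finrank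
    (f := hO.cliffordRep.toLinearMap) ?_).1 hO.cliffordRep_injective
  rw [finrank_cliffordAlgebra, Module.finrank_linearMap, Module.finrank_prod, hO.finrank_eq]
  norm_num

theorem spin_injective (hO : IsCayleyAlgebra n) {c d : even n}
    (h₁ : hO.spinPlus c = hO.spinPlus d) (h₂ : hO.spinMinus c = hO.spinMinus d) : c = d :=
  Subtype.ext (hO.cliffordRep_injective (by
    rw [hO.cliffordRep_even, hO.cliffordRep_even, h₁, h₂]))

theorem spin_surjective (hO : IsCayleyAlgebra n) (f g : Module.End F O) :
    ∃ c, hO.spinPlus c = f ∧ hO.spinMinus c = g := by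
  obtain ⟨w, hw⟩ := hO.cliffordRep_surjective (f.prodMap g)
  have hmem : w ∈ evenOdd n 0 ⊔ evenOdd n 1 := by
    rw [(evenOdd_isCompl n).sup_eq_top]; trivial
  obtain ⟨c, hc, d, hd, rfl⟩ := Submodule.mem_sup.1 hmem
  -- Since `n 1 = 1`, the odd part `d` is the vector `1` times an even element. It is thus
  -- represented off the diagonal and does not affect the diagonal blocks compared below.
  have hd' : ι n 1 * d ∈ evenOdd n 0 :=
    evenOdd_mul_le n 1 1 (Submodule.mul_mem_mul (ι_mem_evenOdd_one n 1) hd)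
  have hdd : d = ι n 1 * (ι n 1 * d) := by
    rw [← mul_assoc, ι_sq_scalar, hO.norm_one, map_one, one_mul]
  have hc₂ := hO.cliffordRep_even ⟨c, hc⟩
  have hd₂ := hO.cliffordRep_even ⟨ι n 1 * d, hd'⟩
  dsimp only at hc₂ hd₂
  rw [map_add, hdd, _root_.map_mul, hO.cliffordRep_ι, hc₂, hd₂] at hw
  refine ⟨⟨c, hc⟩, LinearMap.ext fun a => ?_, LinearMap.ext fun a => ?_⟩
  · have h := congrArg Prod.fst (LinearMap.congr_fun hw (a, 0))
    simpa using h
  · have h := congrArg Prod.snd (LinearMap.congr_fun hw (0, a))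
    simpa using h

end IsCayleyAlgebra

end Representation

/-! ### Triality triples of similitudes -/

section Triples

open CliffordAlgebra

variable {F O : Type*} [Field F] [NonAssocRing O] [Module F O]

/-- The similitudes `t`, `tp`, `tm` with multipliers `μ`, `μp`, `μm` satisfy the triality
relations. -/
structure IsTriple (n : QuadraticForm F O) (t tp tm : O ≃ₗ[F] O) (μ μp μm : Fˣ) : Prop where
  sim : IsSimilitude n t μ
  sim_p : IsSimilitude n tp μp
  sim_m : IsSimilitude n tm μm
  rel_a : ∀ x y : O, tp (paraCayley n x y) = (μp : F) • paraCayley n (t x) (tm y)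
  rel_b : ∀ x y : O, t (paraCayley n x y) = (μ : F) • paraCayley n (tm x) (tp y)
  rel_c : ∀ x y : O, tm (paraCayley n x y) = (μm : F) • paraCayley n (tp x) (t y)

variable {n : QuadraticForm F O}

theorem IsSimilitude.polar {t : O ≃ₗ[F] O} {μ : Fˣ} (h : IsSimilitude n t μ) (x y : O) :
    QuadraticMap.polar n (t x) (t y) = μ * QuadraticMap.polar n x y := by
  simp only [QuadraticMap.polar, ← map_add, h _]
  ring

theorem multiplier_fix (t : GOPlus n) :
    ∀ z ∈ Subalgebra.center F (even n), evenMap (multiplier_spec t) z = z :=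
  t.2.choose_spec.choose_spec

theorem exists_linearEquiv_of_similitude [IsScalarTower F O O] [SMulCommClass F O O]
    (hO : IsCayleyAlgebra n) (f : O →ₗ[F] O) (k : Fˣ) (hf : ∀ x, n (f x) = k * n x) :
    ∃ e : O ≃ₗ[F] O, ∀ x, e x = f x := by
  have := hO.finite
  have hinj : Function.Injective f := by
    rw [← LinearMap.ker_eq_bot, LinearMap.ker_eq_bot']
    intro x hx
    refine hO.nonsingular.1 x fun y => ?_
    have h : k * QuadraticMap.polar n x y = 0 := by
      rw [QuadraticMap.polar, mul_sub, mul_sub, ← hf, ← hf, ← hf, map_add, hx, zero_add,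
        QuadraticMap.map_zero, sub_zero, sub_self]
    exact (mul_eq_zero.1 h).resolve_left k.ne_zero
  exact ⟨LinearEquiv.ofInjectiveEndo f hinj, fun x => rfl⟩

namespace IsTriple

variable {t tp tm : O ≃ₗ[F] O} {μ μp μm : Fˣ}

theorem rotate (h : IsTriple n t tp tm μ μp μm) : IsTriple n tp tm t μp μm μ :=
  ⟨h.sim_p, h.sim_m, h.sim, h.rel_c, h.rel_a, h.rel_b⟩

variable [IsScalarTower F O O] [SMulCommClass F O O]

/-- Taking norms in (a) at `x = y = 1` gives `μp = μp² μ μm`. -/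
theorem multiplier_mul (h : IsTriple n t tp tm μ μp μm) (hO : IsCayleyAlgebra n) :
    μp * μ * μm = 1 := by
  have h1 := congrArg n (h.rel_a 1 1)
  rw [h.sim_p, hO.norm_paraCayley, QuadraticMap.map_smul, hO.norm_paraCayley, h.sim, h.sim_m,
    hO.norm_one, smul_eq_mul] at h1
  refine Units.ext (mul_left_cancel₀ μp.ne_zero ?_)
  push_cast
  linear_combination -h1

theorem multiplier_inv (h : IsTriple n t tp tm μ μp μm) (hO : IsCayleyAlgebra n) :
    ((μ⁻¹ : Fˣ) : F) = μp * μm := by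
  rw [← Units.val_mul]
  congr 1
  rw [inv_eq_iff_mul_eq_one, ← h.multiplier_mul hO]
  exact (mul_left_comm μ μp μm).trans (mul_assoc μp μ μm).symm

/-- Applying (a) and then (c) to `tp (x ⋆ (a ⋆ y))` produces the factor `μp μm = μ⁻¹`, exactly the
one in `C₀(t)(x y)`. -/
theorem spinPlus_evenMap (h : IsTriple n t tp tm μ μp μm) (hO : IsCayleyAlgebra n)
    (c : even n) (a : O) :
    hO.spinPlus (evenMap h.sim c) (tp a) = tp (hO.spinPlus c a) := by
  have key : hO.spinPlus.comp (evenMap h.sim) =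
      (tp.conjAlgEquiv F : Module.End F O →ₐ[F] Module.End F O).comp hO.spinPlus := by
    refine even.algHom_ext n (EvenHom.ext (LinearMap.ext fun x => LinearMap.ext fun y =>
      LinearMap.ext fun p => ?_))
    change hO.spinPlus (evenMap h.sim ((even.ι n).bilin x y)) p =
      tp (hO.spinPlus ((even.ι n).bilin x y) (tp.symm p))
    rw [evenMap_ι, map_smul, LinearMap.smul_apply, hO.spinPlus_ι, hO.spinPlus_ι, h.rel_a, h.rel_c,
      paraCayley_smul, smul_smul, LinearEquiv.apply_symm_apply, h.multiplier_inv hO]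
  have h1 := LinearMap.congr_fun (DFunLike.congr_fun key c) (tp a)
  change _ = tp (hO.spinPlus c (tp.symm (tp a))) at h1
  rwa [LinearEquiv.symm_apply_apply] at h1

theorem spinMinus_evenMap (h : IsTriple n t tp tm μ μp μm) (hO : IsCayleyAlgebra n)
    (c : even n) (a : O) :
    hO.spinMinus (evenMap h.sim c) (tm a) = tm (hO.spinMinus c a) := by
  have key : hO.spinMinus.comp (evenMap h.sim) =
      (tm.conjAlgEquiv F : Module.End F O →ₐ[F] Module.End F O).comp hO.spinMinus := by
    refine even.algHom_ext n (EvenHom.ext (LinearMap.ext fun x => LinearMap.ext fun y =>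
      LinearMap.ext fun p => ?_))
    change hO.spinMinus (evenMap h.sim ((even.ι n).bilin x y)) p =
      tm (hO.spinMinus ((even.ι n).bilin x y) (tm.symm p))
    rw [evenMap_ι, map_smul, LinearMap.smul_apply, hO.spinMinus_ι, hO.spinMinus_ι, h.rel_c,
      h.rel_a, smul_paraCayley, smul_smul, LinearEquiv.apply_symm_apply, h.multiplier_inv hO,
      mul_comm]
  have h1 := LinearMap.congr_fun (DFunLike.congr_fun key c) (tm a)
  change _ = tm (hO.spinMinus c (tm.symm (tm a))) at h1
  rwa [LinearEquiv.symm_apply_apply] at h1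

/-- On both factors `End O`, `C₀(t)` is conjugation by an element of that factor, which fixes the
center. -/
theorem mem_GOPlus (h : IsTriple n t tp tm μ μp μm) (hO : IsCayleyAlgebra n) : t ∈ GOPlus n := by
  refine ⟨μ, h.sim, fun z hz => hO.spin_injective (LinearMap.ext fun a => ?_)
    (LinearMap.ext fun a => ?_)⟩
  · obtain ⟨b, rfl⟩ := tp.surjective a
    obtain ⟨c, hc, -⟩ := hO.spin_surjective (tp : O →ₗ[F] O) 0
    have h1 := congrArg hO.spinPlus (Subalgebra.mem_center_iff.1 hz c)
    rw [map_mul, map_mul, hc] at h1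
    rw [h.spinPlus_evenMap hO]
    exact LinearMap.congr_fun h1 b
  · obtain ⟨b, rfl⟩ := tm.surjective a
    obtain ⟨c, -, hc⟩ := hO.spin_surjective 0 (tm : O →ₗ[F] O)
    have h1 := congrArg hO.spinMinus (Subalgebra.mem_center_iff.1 hz c)
    rw [map_mul, map_mul, hc] at h1
    rw [h.spinMinus_evenMap hO]
    exact LinearMap.congr_fun h1 b

theorem exists_smul_eq {sp sm : O ≃ₗ[F] O} {νp νm : Fˣ}
    (h : IsTriple n t tp tm μ μp μm) (h' : IsTriple n t sp sm μ νp νm) (hO : IsCayleyAlgebra n) :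
    ∃ c : Fˣ, (∀ x, sp x = ((c⁻¹ : Fˣ) : F) • tp x) ∧ ∀ x, sm x = (c : F) • tm x := by
  -- Both `sp` and `tp` implement `C₀(t)` on the first factor; equal conjugations of `End O` come
  -- from proportional maps.
  obtain ⟨d, hd⟩ : ∃ d : F, ⇑sp = d • ⇑tp := by
    refine LinearEquiv.conjAlgEquiv_ext_iff.1 (AlgEquiv.ext fun f => ?_)
    obtain ⟨c, rfl, -⟩ := hO.spin_surjective f 0
    refine LinearMap.ext fun a => ?_
    change sp (hO.spinPlus c (sp.symm a)) = tp (hO.spinPlus c (tp.symm a))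
    rw [← h.spinPlus_evenMap hO, ← h'.spinPlus_evenMap hO, LinearEquiv.apply_symm_apply,
      LinearEquiv.apply_symm_apply]
  replace hd : ∀ x, sp x = d • tp x := congrFun hd
  have hd0 : d ≠ 0 := by
    rintro rfl
    have h1 := h'.sim_p 1
    rw [hd, zero_smul, QuadraticMap.map_zero, hO.norm_one, mul_one] at h1
    exact νp.ne_zero h1.symm
  have hν : (νp : F) = d * d * μp := by
    have h1 := h'.sim_p 1
    rw [hd, QuadraticMap.map_smul, h.sim_p, hO.norm_one, mul_one, mul_one, smul_eq_mul] at h1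
    exact h1.symm
  refine ⟨(Units.mk0 d hd0)⁻¹, fun x => by rw [hd, inv_inv, Units.val_mk0], fun x => ?_⟩
  have h1 := h'.rel_a 1 x
  rw [hd, h.rel_a, hν] at h1
  -- Multiplying on the right by `t 1` cancels the left factor `t 1`, since `(u ⋆ v) ⋆ u = n(u) v`.
  have h2 := congrArg (fun z => paraCayley n z (t 1)) h1
  simp only [smul_paraCayley] at h2
  rw [hO.paraCayley_paraCayley_left, hO.paraCayley_paraCayley_left, h.sim, hO.norm_one, smul_smul,
    smul_smul, smul_smul, mul_one] at h2
  have h3 : d * μp * μ ≠ 0 := mul_ne_zero (mul_ne_zero hd0 μp.ne_zero) μ.ne_zero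
  have h4 : tm x = d • sm x := by
    refine smul_right_injective O h3 ?_
    dsimp only
    rw [h2, smul_smul]
    congr 1
    ring
  rw [h4, Units.val_inv_eq_inv_val, Units.val_mk0, inv_smul_smul₀ hd0]

end IsTriple

/-- If three similitudes satisfy the first and the third triality relation, with multipliers of
product `1`, they satisfy the second one as well. -/
theorem IsTriple.of_rel_a_c [IsScalarTower F O O] [SMulCommClass F O O] (hO : IsCayleyAlgebra n)
    {t tp tm : O ≃ₗ[F] O} {μ μp μm : Fˣ} (sim : IsSimilitude n t μ) (sim_p : IsSimilitude n tp μp)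
    (sim_m : IsSimilitude n tm μm)
    (rel_a : ∀ x y : O, tp (paraCayley n x y) = (μp : F) • paraCayley n (t x) (tm y))
    (rel_c : ∀ x y : O, tm (paraCayley n x y) = (μm : F) • paraCayley n (tp x) (t y)) :
    IsTriple n t tp tm μ μp μm := by
  refine ⟨sim, sim_p, sim_m, rel_a, fun y z => ?_, rel_c⟩
  refine hO.ext_polar fun w => ?_
  obtain ⟨x, rfl⟩ := t.surjective w
  have h1 := sim_p.polar (paraCayley n x y) z
  rw [rel_a, QuadraticMap.polar_smul_left, hO.polar_paraCayley, hO.polar_paraCayley,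
    smul_eq_mul] at h1
  rw [QuadraticMap.polar_comm, sim.polar, QuadraticMap.polar_smul_left, smul_eq_mul,
    QuadraticMap.polar_comm n (paraCayley n (tm y) (tp z)), mul_left_cancel₀ μp.ne_zero h1]

/-- The endomorphism of `End O` induced by a proper similitude through the first half-spin
representation is inner. -/
theorem exists_conj_spinPlus [IsScalarTower F O O] [SMulCommClass F O O] (hO : IsCayleyAlgebra n)
    (t : GOPlus n) : ∃ g : O ≃ₗ[F] O, ∀ c a,
      hO.spinPlus (evenMap (multiplier_spec t) c) (g a) = g (hO.spinPlus c a) := by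
  have := hO.finite
  have hfix := multiplier_fix t
  set φ := evenMap (multiplier_spec t) with hφ
  let σ : even n ≃ₐ[F] Module.End F O × Module.End F O :=
    AlgEquiv.ofBijective (hO.spinPlus.prod hO.spinMinus)
      ⟨fun c d h => hO.spin_injective (Prod.ext_iff.1 h).1 (Prod.ext_iff.1 h).2, fun p => by
        obtain ⟨c, h1, h2⟩ := hO.spin_surjective p.1 p.2
        exact ⟨c, Prod.ext h1 h2⟩⟩
  have hσ1 : ∀ c, (σ c).1 = hO.spinPlus c := fun c => rfl
  have hσ2 : ∀ c, (σ c).2 = hO.spinMinus c := fun c => rfl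
  -- The element `e` corresponding to `(0, 1)` is central, hence fixed by `φ`, and the kernel of
  -- `spinPlus` consists of the `c` with `c = c * e`.
  have hker : ∀ c, hO.spinPlus c = 0 → hO.spinPlus (φ c) = 0 := by
    intro c hc
    obtain ⟨e, he1, he2⟩ := hO.spin_surjective 0 1
    have hez : e ∈ Subalgebra.center F (even n) := by
      rw [Subalgebra.mem_center_iff]
      intro b
      refine hO.spin_injective ?_ ?_
      · rw [map_mul, map_mul, he1, mul_zero, zero_mul]
      · rw [map_mul, map_mul, he2, mul_one, one_mul]
    have hce : c = c * e := by
      refine hO.spin_injective ?_ ?_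
      · rw [map_mul, he1, mul_zero, hc]
      · rw [map_mul, he2, mul_one]
    rw [hce, map_mul, map_mul, hfix e hez, he1, mul_zero]
  -- Induced map on the first factor: `f` is lifted along the diagonal `(f, f)`, a unital section;
  -- by `hker` the choice of lift is immaterial.
  let ψ : Module.End F O →ₐ[F] Module.End F O :=
    ((hO.spinPlus.comp φ).comp (σ.symm : _ →ₐ[F] even n)).comp
      ((AlgHom.id F (Module.End F O)).prod (AlgHom.id F (Module.End F O)))
  have hψ : ∀ c, ψ (hO.spinPlus c) = hO.spinPlus (φ c) := by
    intro c
    change hO.spinPlus (φ (σ.symm (hO.spinPlus c, hO.spinPlus c))) = _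
    rw [← sub_eq_zero, ← map_sub, ← map_sub]
    refine hker _ ?_
    rw [map_sub, ← hσ1, AlgEquiv.apply_symm_apply, sub_self]
  have hφs : Function.Surjective φ := by
    intro c
    have h := evenMap_mul (multiplier_spec t) (multiplier_spec t).inv
    rw [evenMap_eq_id _ 1 (by simp) (by simp)] at h
    exact ⟨evenMap (multiplier_spec t).inv c, (DFunLike.congr_fun h c).symm⟩
  have hψs : Function.Surjective ψ := by
    intro f
    obtain ⟨c, rfl, -⟩ := hO.spin_surjective f 0
    obtain ⟨d, rfl⟩ := hφs c
    exact ⟨_, hψ d⟩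
  have hψi : Function.Injective ψ :=
    LinearMap.injective_iff_surjective (f := ψ.toLinearMap).2 hψs
  -- Skolem–Noether for `End O`.
  obtain ⟨g, hg⟩ := (AlgEquiv.ofBijective ψ ⟨hψi, hψs⟩).eq_linearEquivConjAlgEquiv
  refine ⟨g, fun c a => ?_⟩
  have h1 : ψ (hO.spinPlus c) (g a) = g (hO.spinPlus c (g.symm (g a))) :=
    LinearMap.congr_fun (DFunLike.congr_fun hg (hO.spinPlus c)) (g a)
  rwa [hψ, LinearEquiv.symm_apply_apply] at h1

theorem exists_isTriple [IsScalarTower F O O] [SMulCommClass F O O] (hO : IsCayleyAlgebra n)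
    (t : GOPlus n) : ∃ (tp tm : O ≃ₗ[F] O) (μp μm : Fˣ),
      IsTriple n (t : O ≃ₗ[F] O) tp tm (multiplier t) μp μm := by
  obtain ⟨g, hg⟩ := exists_conj_spinPlus hO t
  have ht := multiplier_spec t
  set μ := multiplier t
  set T : O ≃ₗ[F] O := (t : O ≃ₗ[F] O)
  have hn1 := hO.norm_one
  have hg' : ∀ x y a, g (paraCayley n x (paraCayley n a y)) =
      ((μ⁻¹ : Fˣ) : F) • paraCayley n (T x) (paraCayley n (g a) (T y)) := by
    intro x y a
    have h := hg ((even.ι n).bilin x y) a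
    rw [evenMap_ι, map_smul, LinearMap.smul_apply, hO.spinPlus_ι, hO.spinPlus_ι] at h
    exact h.symm
  -- Chosen by substituting `x ⋆ z = x ⋆ ((1 ⋆ z) ⋆ 1)` in `hg'`, which gives `g (x ⋆ z) = T x ⋆ u
  -- z`.
  let u : O →ₗ[F] O := ((μ⁻¹ : Fˣ) : F) • ((paraCayleyBilin n).flip (T 1) ∘ₗ
    (g : O →ₗ[F] O) ∘ₗ paraCayleyBilin n 1)
  have hu : ∀ z, u z = ((μ⁻¹ : Fˣ) : F) • paraCayley n (g (paraCayley n 1 z)) (T 1) := fun _ => rfl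
  have hgu : ∀ x z, g (paraCayley n x z) = paraCayley n (T x) (u z) := by
    intro x z
    have h := hg' x 1 (paraCayley n 1 z)
    rwa [hO.paraCayley_paraCayley_left, hn1, one_smul, ← paraCayley_smul, ← hu] at h
  have hug : ∀ z y, u (paraCayley n z y) = ((μ⁻¹ : Fˣ) : F) • paraCayley n (g z) (T y) := by
    intro z y
    rw [hu, hg', smul_paraCayley, hO.paraCayley_paraCayley_left, ht, hn1, mul_one, smul_smul,
      smul_smul, mul_assoc, Units.inv_mul, mul_one]
  -- Writing `x = x̄ ⋆ 1` shows that `g` is a similitude.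
  have hng : ∀ x, n (g x) = μ * n (u 1) * n x := by
    intro x
    have h := hgu (conj n x) 1
    rw [paraCayley, hO.conj_conj, hO.conj_one, mul_one] at h
    rw [h, hO.norm_paraCayley, ht, hO.norm_conj]
    ring
  have hk : (μ : F) * n (u 1) ≠ 0 := by
    intro h0
    have h := hng (g.symm 1)
    rw [LinearEquiv.apply_symm_apply, hn1, h0, zero_mul] at h
    exact one_ne_zero h
  obtain ⟨k, hk⟩ : ∃ k : Fˣ, (k : F) = μ * n (u 1) := ⟨Units.mk0 _ hk, rfl⟩
  rw [← hk] at hng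
  have hnu : ∀ x, n (u x) = ((μ⁻¹ : Fˣ) : F) * k * n x := by
    intro x
    have h := hng (paraCayley n 1 x)
    rw [hgu, hO.norm_paraCayley, hO.norm_paraCayley, ht, hn1, mul_one, one_mul] at h
    rw [mul_assoc, ← h, ← mul_assoc, Units.inv_mul, one_mul]
  -- The factor `k⁻¹` on `u` absorbs the multiplier `k` of `g` required in (a).
  obtain ⟨tm, htm⟩ := exists_linearEquiv_of_similitude hO (((k⁻¹ : Fˣ) : F) • u) (k⁻¹ * μ⁻¹)
    fun x => by
      rw [LinearMap.smul_apply, QuadraticMap.map_smul, hnu, smul_eq_mul, Units.val_mul]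
      linear_combination ((k⁻¹ : Fˣ) : F) * ((μ⁻¹ : Fˣ) : F) * n x * k.inv_mul
  refine ⟨g, tm, k, k⁻¹ * μ⁻¹, IsTriple.of_rel_a_c hO ht hng ?_ (fun x y => ?_) fun x y => ?_⟩
  · intro x
    rw [htm, LinearMap.smul_apply, QuadraticMap.map_smul, hnu, smul_eq_mul, Units.val_mul]
    linear_combination ((k⁻¹ : Fˣ) : F) * ((μ⁻¹ : Fˣ) : F) * n x * k.inv_mul
  · rw [htm, LinearMap.smul_apply, paraCayley_smul, smul_smul, Units.mul_inv, one_smul, hgu]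
  · rw [htm, LinearMap.smul_apply, hug, smul_smul, Units.val_mul]

end Triples

/-! ### The action of `A₃` on `PGO⁺(n)` -/

section TrialityAction

variable {F O : Type*} [Field F] [NonAssocRing O] [Module F O]
  {n : QuadraticForm F O}

theorem TrialityRelations.rotate {t tp tm : GOPlus n} (h : TrialityRelations n t tp tm) :
    TrialityRelations n tp tm t :=
  ⟨h.rel_c, h.rel_a, h.rel_b⟩

theorem TrialityRelations.isTriple {t tp tm : GOPlus n} (h : TrialityRelations n t tp tm) :
    IsTriple n (t : O ≃ₗ[F] O) tp tm (multiplier t) (multiplier tp) (multiplier tm) :=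
  ⟨multiplier_spec t, multiplier_spec tp, multiplier_spec tm, h.rel_a, h.rel_b, h.rel_c⟩

theorem multiplier_mul (hn : n ≠ 0) (s t : GOPlus n) :
    multiplier (s * t) = multiplier s * multiplier t :=
  multiplier_unique hn _ ((multiplier_spec s).mul (multiplier_spec t))

theorem multiplier_homothety (hn : n ≠ 0) (c : Fˣ) : multiplier (homothety n c) = c * c :=
  multiplier_unique hn _ fun x => (QuadraticMap.map_smul n (c : F) x).trans (by
    rw [smul_eq_mul, Units.val_mul])

theorem coe_homothety_apply (c : Fˣ) (x : O) :
    (homothety n c : O ≃ₗ[F] O) x = (c : F) • x := rfl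

theorem coe_mul_apply (s t : GOPlus n) (x : O) :
    ((s * t : GOPlus n) : O ≃ₗ[F] O) x = (s : O ≃ₗ[F] O) ((t : O ≃ₗ[F] O) x) := rfl

theorem TrialityRelations.mul (hn : n ≠ 0) {s sp sm t tp tm : GOPlus n}
    (hs : TrialityRelations n s sp sm) (ht : TrialityRelations n t tp tm) :
    TrialityRelations n (s * t) (sp * tp) (sm * tm) := by
  refine ⟨fun x y => ?_, fun x y => ?_, fun x y => ?_⟩
  · rw [coe_mul_apply, ht.rel_a, map_smul, hs.rel_a, smul_smul, multiplier_mul hn, Units.val_mul,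
      mul_comm]
    rfl
  · rw [coe_mul_apply, ht.rel_b, map_smul, hs.rel_b, smul_smul, multiplier_mul hn, Units.val_mul,
      mul_comm]
    rfl
  · rw [coe_mul_apply, ht.rel_c, map_smul, hs.rel_c, smul_smul, multiplier_mul hn, Units.val_mul,
      mul_comm]
    rfl

theorem cls_mul_homothety (t : GOPlus n) (c : Fˣ) : cls (t * homothety n c) = cls t :=
  QuotientGroup.mk_mul_of_mem t ⟨c, rfl⟩

variable [IsScalarTower F O O] [SMulCommClass F O O]

/-- Combined with rotation and multiplication of triples, this gives both the scalar freedom `(c⁻¹,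
c)` and the independence of `[t⁺]` from the representative of `[t]`. -/
theorem TrialityRelations.homothety (hn : n ≠ 0) (c : Fˣ) :
    TrialityRelations n (homothety n c) (homothety n c⁻¹) 1 := by
  have h1 : multiplier (1 : GOPlus n) = 1 := multiplier_unique hn 1 (IsSimilitude.one n)
  have h2 : ∀ x : O, ((1 : GOPlus n) : O ≃ₗ[F] O) x = x := fun _ => rfl
  refine ⟨fun x y => ?_, fun x y => ?_, fun x y => ?_⟩
  · rw [multiplier_homothety hn, h2, coe_homothety_apply, coe_homothety_apply, smul_paraCayley,
      smul_smul, Units.val_mul, mul_assoc, Units.inv_mul, mul_one]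
  · rw [multiplier_homothety hn, h2, coe_homothety_apply, coe_homothety_apply, paraCayley_smul,
      smul_smul, Units.val_mul, mul_assoc, Units.mul_inv, mul_one]
  · rw [h1, h2, coe_homothety_apply, coe_homothety_apply, paraCayley_smul, smul_paraCayley,
      smul_smul, smul_smul, Units.val_one, one_mul, Units.mul_inv, one_smul]

theorem exists_trialityRelations (hO : IsCayleyAlgebra n) (t : GOPlus n) :
    ∃ tp tm : GOPlus n, TrialityRelations n t tp tm := by
  obtain ⟨tp, tm, μp, μm, h⟩ := exists_isTriple hO t
  lift tp to GOPlus n using h.rotate.mem_GOPlus hO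
  lift tm to GOPlus n using h.rotate.rotate.mem_GOPlus hO
  obtain rfl := multiplier_unique hO.ne_zero tp h.sim_p
  obtain rfl := multiplier_unique hO.ne_zero tm h.sim_m
  exact ⟨tp, tm, h.rel_a, h.rel_b, h.rel_c⟩

theorem trialityRelations_iff (hO : IsCayleyAlgebra n) {t tp tm : GOPlus n}
    (h : TrialityRelations n t tp tm) (sp sm : GOPlus n) :
    TrialityRelations n t sp sm ↔
      ∃ c : Fˣ, sp = tp * homothety n c⁻¹ ∧ sm = tm * homothety n c := by
  constructor
  · intro h'
    obtain ⟨c, h1, h2⟩ := h.isTriple.exists_smul_eq h'.isTriple hO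
    exact ⟨c, Subtype.ext (LinearEquiv.ext fun x => (h1 x).trans (map_smul tp.1 _ x).symm),
      Subtype.ext (LinearEquiv.ext fun x => (h2 x).trans (map_smul tm.1 _ x).symm)⟩
  · rintro ⟨c, rfl, rfl⟩
    -- The rotated triple is `(1, c⁻¹, c)`.
    have h1 := h.mul hO.ne_zero ((TrialityRelations.homothety hO.ne_zero c⁻¹).rotate.rotate)
    rwa [mul_one, inv_inv] at h1

theorem cls_eq_cls_of_trialityRelations (hO : IsCayleyAlgebra n) {s sp sm t tp tm : GOPlus n}
    (hs : TrialityRelations n s sp sm) (ht : TrialityRelations n t tp tm) (h : cls s = cls t) :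
    cls sp = cls tp := by
  obtain ⟨c, hc⟩ := QuotientGroup.eq.1 h
  obtain rfl : t = s * homothety n c := by rw [hc, mul_inv_cancel_left]
  have h1 := hs.mul hO.ne_zero (TrialityRelations.homothety hO.ne_zero c)
  obtain ⟨d, rfl, -⟩ := (trialityRelations_iff hO h1 tp tm).1 ht
  rw [cls_mul_homothety, cls_mul_homothety]

/-- The endomorphism `[t] ↦ [t⁺]` of `PGO⁺(n)`. -/
noncomputable def thetaPlus (hO : IsCayleyAlgebra n) : PGOPlus n →* PGOPlus n :=
  QuotientGroup.lift (homothety n).range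
    (MonoidHom.mk' (fun t => cls (exists_trialityRelations hO t).choose) fun s t =>
      cls_eq_cls_of_trialityRelations hO
        (exists_trialityRelations hO (s * t)).choose_spec.choose_spec
        ((exists_trialityRelations hO s).choose_spec.choose_spec.mul hO.ne_zero
          (exists_trialityRelations hO t).choose_spec.choose_spec) rfl)
    (by
      rintro _ ⟨c, rfl⟩
      refine (cls_eq_cls_of_trialityRelations hO
        (exists_trialityRelations hO _).choose_spec.choose_spec
        (TrialityRelations.homothety hO.ne_zero c) rfl).trans ?_
      exact (QuotientGroup.eq_one_iff _).2 ⟨_, rfl⟩)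

theorem thetaPlus_cls (hO : IsCayleyAlgebra n) {t tp tm : GOPlus n}
    (h : TrialityRelations n t tp tm) : thetaPlus hO (cls t) = cls tp :=
  cls_eq_cls_of_trialityRelations hO (exists_trialityRelations hO t).choose_spec.choose_spec h rfl

theorem thetaPlus_thetaPlus_thetaPlus (hO : IsCayleyAlgebra n) (x : PGOPlus n) :
    thetaPlus hO (thetaPlus hO (thetaPlus hO x)) = x := by
  obtain ⟨t, rfl⟩ := QuotientGroup.mk_surjective x
  obtain ⟨tp, tm, h⟩ := exists_trialityRelations hO t
  change thetaPlus hO (thetaPlus hO (thetaPlus hO (cls t))) = cls t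
  rw [thetaPlus_cls hO h, thetaPlus_cls hO h.rotate, thetaPlus_cls hO h.rotate.rotate]

/-- The automorphism `[t] ↦ [t⁺]` of `PGO⁺(n)`. -/
noncomputable def thetaPlusAut (hO : IsCayleyAlgebra n) : MulAut (PGOPlus n) :=
  MulEquiv.mk' ⟨thetaPlus hO, fun x => thetaPlus hO (thetaPlus hO x),
    thetaPlus_thetaPlus_thetaPlus hO, thetaPlus_thetaPlus_thetaPlus hO⟩ (map_mul (thetaPlus hO))

theorem thetaPlusAut_pow (hO : IsCayleyAlgebra n) : thetaPlusAut hO ^ 3 = 1 := by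
  refine MulEquiv.ext fun x => ?_
  rw [pow_succ, pow_two]
  exact thetaPlus_thetaPlus_thetaPlus hO x

theorem mem_zpowers_threeCycle (x : alternatingGroup (Fin 3)) :
    x ∈ Subgroup.zpowers threeCycle := by
  have h : ∀ x : alternatingGroup (Fin 3), x = threeCycle ^ 0 ∨ x = threeCycle ^ 1 ∨
      x = threeCycle ^ 2 := by decide
  rcases h x with rfl | rfl | rfl <;> exact Subgroup.npow_mem_zpowers _ _

theorem orderOf_threeCycle : orderOf threeCycle = 3 :=
  orderOf_eq_prime (by decide) (by decide)

theorem existsUnique_triality_action (hO : IsCayleyAlgebra n) :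
    ∃! θ : alternatingGroup (Fin 3) →* MulAut (PGOPlus n),
      ∀ t tp tm : GOPlus n, TrialityRelations n t tp tm →
        θ threeCycle (cls t) = cls tp ∧ θ threeCycle⁻¹ (cls t) = cls tm := by
  have hdvd : orderOf (thetaPlusAut hO) ∣ orderOf threeCycle := by
    rw [orderOf_threeCycle]
    exact orderOf_dvd_of_pow_eq_one (thetaPlusAut_pow hO)
  have hgen := monoidHomOfForallMemZpowers_apply_gen mem_zpowers_threeCycle hdvd
  refine ⟨monoidHomOfForallMemZpowers mem_zpowers_threeCycle hdvd, fun t tp tm h => ?_, ?_⟩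
  · rw [map_inv, hgen]
    refine ⟨thetaPlus_cls hO h, ?_⟩
    rw [MulAut.inv_apply, MulEquiv.symm_apply_eq]
    -- Two rotations give the triple `(t⁻, t, t⁺)`, so `θ⁺` sends `[t⁻]` to `[t]`.
    exact (thetaPlus_cls hO h.rotate.rotate).symm
  · intro θ hθ
    refine (MonoidHom.eq_iff_eq_on_generator mem_zpowers_threeCycle _ _).2 ?_
    rw [hgen]
    refine MulEquiv.ext fun x => ?_
    obtain ⟨t, rfl⟩ := QuotientGroup.mk_surjective x
    obtain ⟨tp, tm, h⟩ := exists_trialityRelations hO t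
    exact (hθ t tp tm h).1.trans (thetaPlus_cls hO h).symm

end TrialityAction

end Triality

theorem mainTheorem5 {F O : Type*} [Field F] [NonAssocRing O] [Module F O]
    [IsScalarTower F O O] [SMulCommClass F O O]
    (n : QuadraticForm F O) (hO : Triality.IsCayleyAlgebra n) :
    (∀ t : Triality.GOPlus n,
      (∃ tp tm : Triality.GOPlus n, Triality.TrialityRelations n t tp tm) ∧
      ∀ tp tm : Triality.GOPlus n, Triality.TrialityRelations n t tp tm →
        (∀ sp sm : Triality.GOPlus n, Triality.TrialityRelations n t sp sm ↔
          ∃ c : Fˣ, (∀ x : O, sp.1 x = (c⁻¹ : Fˣ) • tp.1 x) ∧ ∀ x : O, sm.1 x = c • tm.1 x) ∧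
        Triality.multiplier tp * Triality.multiplier t * Triality.multiplier tm = 1) ∧
    ∃! θ : alternatingGroup (Fin 3) →* MulAut (Triality.PGOPlus n),
      ∀ t tp tm : Triality.GOPlus n, Triality.TrialityRelations n t tp tm →
        θ Triality.threeCycle (Triality.cls t) = Triality.cls tp ∧
        θ Triality.threeCycle⁻¹ (Triality.cls t) = Triality.cls tm := by
  refine ⟨fun t => ⟨Triality.exists_trialityRelations hO t, fun tp tm h => ⟨fun sp sm => ?_,
    h.isTriple.multiplier_mul hO⟩⟩, Triality.existsUnique_triality_action hO⟩
  rw [Triality.trialityRelations_iff hO h]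
  refine exists_congr fun c => and_congr ?_ ?_
  · rw [Subtype.ext_iff, LinearEquiv.ext_iff]
    exact forall_congr' fun x => by
      rw [Triality.coe_mul_apply, Triality.coe_homothety_apply, map_smul]; rfl
  · rw [Subtype.ext_iff, LinearEquiv.ext_iff]
    exact forall_congr' fun x => by
      rw [Triality.coe_mul_apply, Triality.coe_homothety_apply, map_smul]; rfl
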